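/- Let $n\ge 2$, $k\ge 1$, and let $\mathcal G$ be a connected undirected graph without self-loops on the vertex set $\{1,\dots,k\}$ with edge set $\mathcal E$. For each edge $(i,j)\in\mathcal E$ let $y_{ij}=y_{ji}:\mathbb R\to S^{n-1}\subset\mathbb R^n$ be a smooth function of time and put $M_{ij}(t)=y_{ij}(t)\,y_{ij}(t)^T$. Let $\|\cdot\|_F$ be the Frobenius norm and $\mathrm{skew}(X)=\tfrac12(X-X^T)$. Assume (persistent excitation with uniform averaging) that for every $(i,j)\in\mathcal E$ the limit $$\overline M_{ij}=\lim_{t\to\infty}\frac1{2t}\int_{-t}^{t}M_{ij}(s)\,ds$$ exists and is positive definite, and that there is a function $Z:[0,\infty)\to[0,\infty)$ with $\lim_{T\to\infty}Z(T)/T=0$ such that $$\Big\|\int_t^{t+T}\big(M_{ij}(s)-\overline M_{ij}\big)\,ds\Big\|_F\le Z(T)\qquad\text{for all } t\in\mathbb R,\ T\ge0,\ (i,j)\in\mathcal E .$$ Consider on $SO(n)^k$ the dynamics $$\frac{d}{dt}Q_i=\varepsilon\,Q_i\sum_{j:(i,j)\in\mathcal E}\mathrm{skew}\big(Q_i^TM_{ij}(t)\,Q_j\big),\qquad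 i=1,\dots,k, \tag{1}$$ and the synchronization set $C_s=\{(Q_1,\dots,Q_k)\in SO(n)^k: Q_1=\dots=Q_k\}$. Then for all sufficiently small $\varepsilon>0$ the set $C_s$ is locally exponentially stable for (1). That is, there is $\varepsilon_0>0$ such that for every $\varepsilon\in(0,\varepsilon_0)$ there are $\delta,K,\mu>0$ such that, for all $t_0\le t_1$, every solution $Q$ of (1) on $[t_0,t_1]$ with $\operatorname{dist}(Q(t_0),C_s)<\delta$ satisfies $$\operatorname{dist}(Q(t),C_s)\le K e^{-\mu(t-t_0)}\operatorname{dist}(Q(t_0),C_s)\qquad\text{for all } t\in[t_0,t_1],$$ where $\operatorname{dist}(Q,C_s)=\inf_{P\in C_s}\big(\sum_{i=1}^k\|Q_i-P_i\|_F^2\big)^{1/2}$. -/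

import Mathlib

open Filter Topology
open scoped ContDiff Matrix Matrix.Norms.Frobenius

noncomputable section

namespace PartialSync

/-- The state space `SO(n)^k` of `k` agents. -/
abbrev State (n k : ℕ) : Type := Fin k → Matrix.specialOrthogonalGroup (Fin n) ℝ

/-- The state synchronization set: all agents have the same state. -/
def syncSet (n k : ℕ) : Set (State n k) := {Q | ∀ i j, Q i = Q j}

/-- The skew-symmetric part of a square matrix. -/
def sk {n : ℕ} (X : Matrix (Fin n) (Fin n) ℝ) : Matrix (Fin n) (Fin n) ℝ :=
  (1 / 2 : ℝ) • (X - Xᵀ)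

/-- The matrix `y yᵀ` attached to a reference vector `y`. -/
def proj {n : ℕ} (y : EuclideanSpace ℝ (Fin n)) : Matrix (Fin n) (Fin n) ℝ :=
  Matrix.of fun a b => y a * y b

/-- Time-varying reference vectors on the edges of `G`: smooth functions of time with values in the
unit sphere, with `y i j = y j i`. Values off the edges are irrelevant. -/
structure IsReferenceFamily {n k : ℕ} (G : SimpleGraph (Fin k))
    (y : Fin k → Fin k → ℝ → EuclideanSpace ℝ (Fin n)) : Prop where
  symm : ∀ i j, G.Adj i j → y i j = y j i
  smooth : ∀ i j, G.Adj i j → ContDiff ℝ ∞ (y i j)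
  unit : ∀ i j, G.Adj i j → ∀ t, ‖y i j t‖ = 1

/-- Persistent excitation with uniform averaging: on each edge the time average of `y yᵀ` exists and
is positive definite, and the integrated deviation from it over any window of length `T` is at most
`Z T` in Frobenius norm, with `Z` nonnegative and sublinear, independent of the window and edge. -/
def PersistentlyExciting {n k : ℕ} (G : SimpleGraph (Fin k))
    (y : Fin k → Fin k → ℝ → EuclideanSpace ℝ (Fin n)) : Prop :=
  ∃ Mbar : Fin k → Fin k → Matrix (Fin n) (Fin n) ℝ,
    (∀ i j, G.Adj i j →
      Tendsto (fun t : ℝ => (1 / (2 * t)) • ∫ s in (-t)..t, proj (y i j s)) atTop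
        (𝓝 (Mbar i j)) ∧
      (Mbar i j).PosDef) ∧
    ∃ Z : ℝ → ℝ, (∀ T, 0 ≤ T → 0 ≤ Z T) ∧
      Tendsto (fun T : ℝ => (1 / T) * Z T) atTop (𝓝 0) ∧
      ∀ i j, G.Adj i j → ∀ t T : ℝ, 0 ≤ T →
        ‖∫ s in t..(t + T), (proj (y i j s) - Mbar i j)‖ ≤ Z T

/-- Right-hand side of the scaled coupling law for agent `i` at time `t`. -/
def field {n k : ℕ} (G : SimpleGraph (Fin k)) [DecidableRel G.Adj]
    (y : Fin k → Fin k → ℝ → EuclideanSpace ℝ (Fin n)) (ε : ℝ) (t : ℝ) (Q : State n k)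
    (i : Fin k) : Matrix (Fin n) (Fin n) ℝ :=
  ε • ((Q i).1 * ∑ j ∈ G.neighborFinset i, sk ((Q i).1ᵀ * proj (y i j t) * (Q j).1))

/-- `Q` solves the scaled coupling law on the time interval `[t₀, t₁]`. -/
def IsSolutionOn {n k : ℕ} (G : SimpleGraph (Fin k)) [DecidableRel G.Adj]
    (y : Fin k → Fin k → ℝ → EuclideanSpace ℝ (Fin n)) (ε t₀ t₁ : ℝ) (Q : ℝ → State n k) :
    Prop :=
  ∀ t ∈ Set.Icc t₀ t₁, ∀ i,
    HasDerivWithinAt (fun s => (Q s i).1) (field G y ε t (Q t) i) (Set.Icc t₀ t₁) t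

/-- Distance from a state to a (nonempty) set of states, for the distance
`(∑ i, ‖Q i - P i‖²)^(1/2)` built from the Frobenius norm. -/
def distTo {n k : ℕ} (C : Set (State n k)) (Q : State n k) : ℝ :=
  ⨅ P : C, Real.sqrt (∑ i, ‖(Q i).1 - (P.1 i).1‖ ^ 2)

/-- Local exponential stability of a set of states under the scaled coupling law, uniformly in the
initial time. -/
def IsLocallyExpStable {n k : ℕ} (G : SimpleGraph (Fin k)) [DecidableRel G.Adj]
    (y : Fin k → Fin k → ℝ → EuclideanSpace ℝ (Fin n)) (ε : ℝ) (C : Set (State n k)) : Prop :=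
  ∃ δ > (0 : ℝ), ∃ K > (0 : ℝ), ∃ μ > (0 : ℝ), ∀ (t₀ t₁ : ℝ) (Q : ℝ → State n k), t₀ ≤ t₁ →
    IsSolutionOn G y ε t₀ t₁ Q → distTo C (Q t₀) < δ →
    ∀ t ∈ Set.Icc t₀ t₁, distTo C (Q t) ≤ K * Real.exp (-μ * (t - t₀)) * distTo C (Q t₀)

end PartialSync

end

/-! The Lyapunov function is `disagreement`, the sum V of ‖Q_i - Q_j‖² over all ordered pairs,
including non-adjacent ones; √V is comparable to the distance to the synchronization set. V is
sampled at the ends of windows of a fixed length T.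

Averaged system. On orthogonal matrices the interaction `a * sk (aᵀ * M * b)` equals `coupling M a
b`, which is linear in M and in b and vanishes for b = a. With e = b - a, orthogonality gives two
expansions: ⟨e, coupling M a b⟩ is at least ⟨e, M e⟩ - O(|e|³) (`le_frobInner_sub_coupling`), and
the couplings of a to b and of b to a cancel up to O(|e|²) (`norm_coupling_add_coupling_le`). After
symmetrization over pairs, the change of V along the averaged field is a negative definite sum over
edges plus cubic terms. Connectedness bounds V by the edge sum, so near synchronization the field
dissipates V at a rate c (`exists_dissipation`).

Averaging. The instantaneous weights have rank at most one, so V need not decrease at every time.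
Over a window, with ρ = √V at its start, the increment of Q is εT times the averaged field at the
initial state, up to O(ε Z(T) ρ) + O((εT)² ρ) (`couplingField_averaging`). Each error carries the
factor ρ because the coupling vanishes at synchronization. Choosing T with Z(T)/T small against c,
and then ε small, makes the errors at most half of the decrease 2εcT V
(`disagreement_window_contraction`). The sampled values thus stay in the region of dissipation and
decay geometrically; bounded growth inside a window fills in the remaining times
(`exp_decay_of_window_contraction`). -/

noncomputable section

namespace PartialSync

/-! ### Frobenius geometry and expansions of the coupling on orthogonal matrices -/

section Algebra

variable {n : ℕ}

/-- The Frobenius inner product of two real matrices. -/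
def frobInner (X Y : Matrix (Fin n) (Fin n) ℝ) : ℝ := (Xᵀ * Y).trace

theorem frobInner_self (X : Matrix (Fin n) (Fin n) ℝ) : frobInner X X = ‖X‖ ^ 2 := by
  have h0 : 0 ≤ ∑ i, ∑ j, ‖X i j‖ ^ (2 : ℝ) :=
    Finset.sum_nonneg fun i _ => Finset.sum_nonneg fun j _ => by positivity
  rw [Matrix.frobenius_norm_def, ← Real.sqrt_eq_rpow, Real.sq_sqrt h0, frobInner, Matrix.trace,
    Finset.sum_comm]
  refine Finset.sum_congr rfl fun i _ => ?_
  rw [Matrix.diag_apply, Matrix.mul_apply]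
  refine Finset.sum_congr rfl fun j _ => ?_
  rw [Matrix.transpose_apply, Real.rpow_two, Real.norm_eq_abs, sq_abs, sq]

theorem frobInner_comm (X Y : Matrix (Fin n) (Fin n) ℝ) : frobInner X Y = frobInner Y X := by
  rw [frobInner, frobInner, ← Matrix.trace_transpose, Matrix.transpose_mul,
    Matrix.transpose_transpose]

theorem frobInner_add_right (X Y Z : Matrix (Fin n) (Fin n) ℝ) :
    frobInner X (Y + Z) = frobInner X Y + frobInner X Z := by
  simp [frobInner, mul_add]

theorem frobInner_sub_right (X Y Z : Matrix (Fin n) (Fin n) ℝ) :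
    frobInner X (Y - Z) = frobInner X Y - frobInner X Z := by
  simp [frobInner, mul_sub]

theorem frobInner_sub_left (X Y Z : Matrix (Fin n) (Fin n) ℝ) :
    frobInner (X - Y) Z = frobInner X Z - frobInner Y Z := by
  simp [frobInner, sub_mul]

theorem frobInner_neg_right (X Y : Matrix (Fin n) (Fin n) ℝ) :
    frobInner X (-Y) = -frobInner X Y := by
  simp [frobInner]

theorem frobInner_smul_right (c : ℝ) (X Y : Matrix (Fin n) (Fin n) ℝ) :
    frobInner X (c • Y) = c * frobInner X Y := by
  simp [frobInner]

theorem frobInner_smul_left (c : ℝ) (X Y : Matrix (Fin n) (Fin n) ℝ) :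
    frobInner (c • X) Y = c * frobInner X Y := by
  simp [frobInner]

theorem frobInner_sum_right {ι : Type*} (s : Finset ι) (X : Matrix (Fin n) (Fin n) ℝ)
    (Y : ι → Matrix (Fin n) (Fin n) ℝ) :
    frobInner X (∑ i ∈ s, Y i) = ∑ i ∈ s, frobInner X (Y i) := by
  simp [frobInner, Finset.mul_sum, Matrix.trace_sum]

theorem frobInner_sum_left {ι : Type*} (s : Finset ι) (X : ι → Matrix (Fin n) (Fin n) ℝ)
    (Y : Matrix (Fin n) (Fin n) ℝ) :
    frobInner (∑ i ∈ s, X i) Y = ∑ i ∈ s, frobInner (X i) Y := by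
  simp [frobInner, Finset.sum_mul, Matrix.trace_sum, Matrix.transpose_sum]

theorem norm_add_sq_frob (X Y : Matrix (Fin n) (Fin n) ℝ) :
    ‖X + Y‖ ^ 2 = ‖X‖ ^ 2 + 2 * frobInner X Y + ‖Y‖ ^ 2 := by
  rw [← frobInner_self, ← frobInner_self, ← frobInner_self, frobInner_add_right,
    frobInner_comm (X + Y) X, frobInner_comm (X + Y) Y, frobInner_add_right, frobInner_add_right,
    frobInner_comm Y X]
  ring

/-- Cauchy–Schwarz follows by comparing the expansion of ‖X + Y‖² with the square of the triangle
inequality. -/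
theorem frobInner_le (X Y : Matrix (Fin n) (Fin n) ℝ) : frobInner X Y ≤ ‖X‖ * ‖Y‖ := by
  have h := norm_add_sq_frob X Y
  have h1 : ‖X + Y‖ ^ 2 ≤ (‖X‖ + ‖Y‖) ^ 2 :=
    pow_le_pow_left₀ (norm_nonneg _) (norm_add_le X Y) 2
  nlinarith

theorem abs_frobInner_le (X Y : Matrix (Fin n) (Fin n) ℝ) : |frobInner X Y| ≤ ‖X‖ * ‖Y‖ := by
  refine abs_le.2 ⟨?_, frobInner_le X Y⟩
  have h := frobInner_le X (-Y)
  rw [frobInner_neg_right, norm_neg] at h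
  linarith

theorem norm_sq_of_orthogonal {a : Matrix (Fin n) (Fin n) ℝ} (ha : aᵀ * a = 1) :
    ‖a‖ ^ 2 = n := by
  rw [← frobInner_self, frobInner, ha, Matrix.trace_one, Fintype.card_fin]

theorem norm_of_orthogonal {a : Matrix (Fin n) (Fin n) ℝ} (ha : aᵀ * a = 1) :
    ‖a‖ = √n := by
  rw [← norm_sq_of_orthogonal ha, Real.sqrt_sq (norm_nonneg _)]

/-- The coupling exerted on an agent in state `a` by an agent in state `b` through the symmetric
weight `M`; on orthogonal matrices this is `a * sk (aᵀ * M * b)`. -/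
def coupling (M a b : Matrix (Fin n) (Fin n) ℝ) : Matrix (Fin n) (Fin n) ℝ :=
  (1 / 2 : ℝ) • (M * b - a * bᵀ * M * a)

theorem mul_sk_eq_coupling {M a b : Matrix (Fin n) (Fin n) ℝ} (hM : Mᵀ = M) (ha : a * aᵀ = 1) :
    a * sk (aᵀ * M * b) = coupling M a b := by
  rw [sk, coupling, Matrix.mul_smul, mul_sub, Matrix.transpose_mul, Matrix.transpose_mul, hM,
    Matrix.transpose_transpose]
  congr 2
  · rw [← mul_assoc, ← mul_assoc, ha, one_mul]
  · simp only [mul_assoc]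

theorem coupling_zero (a b : Matrix (Fin n) (Fin n) ℝ) : coupling 0 a b = 0 := by
  simp [coupling]

theorem coupling_sub_weight (M N a b : Matrix (Fin n) (Fin n) ℝ) :
    coupling (M - N) a b = coupling M a b - coupling N a b := by
  simp only [coupling, sub_mul, mul_sub, ← smul_sub]
  congr 1
  abel

theorem coupling_smul_weight (c : ℝ) (M a b : Matrix (Fin n) (Fin n) ℝ) :
    coupling (c • M) a b = c • coupling M a b := by
  simp only [coupling, Matrix.smul_mul, Matrix.mul_smul, ← smul_sub]
  rw [smul_comm]

/-- The coupling is linear in `b`, and M a - a aᵀ M a = 0. This is the source of the factor √V in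
all later error bounds. -/
theorem coupling_eq_coupling_sub {M a b : Matrix (Fin n) (Fin n) ℝ} (ha : a * aᵀ = 1) :
    coupling M a b = coupling M a (b - a) := by
  simp only [coupling, mul_sub, sub_mul, Matrix.transpose_sub, ha, one_mul]
  congr 1
  abel

theorem norm_coupling_le {M a b : Matrix (Fin n) (Fin n) ℝ} (ha : aᵀ * a = 1) :
    ‖coupling M a b‖ ≤ (1 + n) * ‖M‖ * ‖b - a‖ := by
  rw [coupling_eq_coupling_sub (mul_eq_one_comm.1 ha)]
  set e := b - a
  have h1 : ‖M * e‖ ≤ ‖M‖ * ‖e‖ := Matrix.frobenius_norm_mul _ _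
  have h2 : ‖a * eᵀ * M * a‖ ≤ n * (‖M‖ * ‖e‖) := by
    calc ‖a * eᵀ * M * a‖ ≤ ‖a‖ * ‖eᵀ‖ * ‖M‖ * ‖a‖ := by
          refine (Matrix.frobenius_norm_mul _ _).trans ?_
          gcongr
          refine (Matrix.frobenius_norm_mul _ _).trans ?_
          gcongr
          exact Matrix.frobenius_norm_mul _ _
      _ = ‖a‖ ^ 2 * (‖M‖ * ‖e‖) := by rw [Matrix.frobenius_norm_transpose]; ring
      _ = n * (‖M‖ * ‖e‖) := by rw [norm_sq_of_orthogonal ha]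
  rw [coupling, norm_smul]
  have h3 := norm_sub_le (M * e) (a * eᵀ * M * a)
  have h4 : 0 ≤ (1 + n) * ‖M‖ * ‖e‖ := by positivity
  rw [Real.norm_of_nonneg (by norm_num : (0 : ℝ) ≤ 1 / 2)]
  linarith

theorem norm_coupling_sub_le {M a b a' b' : Matrix (Fin n) (Fin n) ℝ} {d : ℝ} (ha : aᵀ * a = 1)
    (hb : bᵀ * b = 1) (ha' : a'ᵀ * a' = 1) (hb' : b'ᵀ * b' = 1) (hda : ‖a - a'‖ ≤ d)
    (hdb : ‖b - b'‖ ≤ d) :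
    ‖coupling M a b - coupling M a' b'‖ ≤ 2 * (1 + n) * ‖M‖ * d := by
  have hd : 0 ≤ d := (norm_nonneg _).trans hda
  -- Telescoping replaces one factor at a time; the remaining orthogonal factors have norm √n.
  have key : coupling M a b - coupling M a' b' = (1 / 2 : ℝ) • (M * (b - b') -
      ((a - a') * bᵀ * M * a + a' * (b - b')ᵀ * M * a + a' * b'ᵀ * M * (a - a'))) := by
    simp only [coupling, mul_sub, sub_mul, Matrix.transpose_sub, ← smul_sub]
    congr 1
    abel
  have prod : ∀ x y z w : Matrix (Fin n) (Fin n) ℝ,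
      ‖x * yᵀ * z * w‖ ≤ ‖x‖ * ‖y‖ * ‖z‖ * ‖w‖ := by
    intro x y z w
    rw [← Matrix.frobenius_norm_transpose y]
    refine (Matrix.frobenius_norm_mul _ _).trans ?_
    gcongr
    refine (Matrix.frobenius_norm_mul _ _).trans ?_
    gcongr
    exact Matrix.frobenius_norm_mul _ _
  have hs : √(n : ℝ) * √(n : ℝ) = n := Real.mul_self_sqrt (Nat.cast_nonneg n)
  have h0 : ‖M * (b - b')‖ ≤ ‖M‖ * d :=
    (Matrix.frobenius_norm_mul _ _).trans (by gcongr)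
  have h1 : ‖(a - a') * bᵀ * M * a‖ ≤ n * ‖M‖ * d := by
    refine (prod _ _ _ _).trans ?_
    rw [norm_of_orthogonal ha, norm_of_orthogonal hb]
    calc ‖a - a'‖ * √n * ‖M‖ * √n = (√n * √n) * ‖M‖ * ‖a - a'‖ := by ring
      _ ≤ n * ‖M‖ * d := by rw [hs]; gcongr
  have h2 : ‖a' * (b - b')ᵀ * M * a‖ ≤ n * ‖M‖ * d := by
    refine (prod _ _ _ _).trans ?_
    rw [norm_of_orthogonal ha, norm_of_orthogonal ha']
    calc √n * ‖b - b'‖ * ‖M‖ * √n = (√n * √n) * ‖M‖ * ‖b - b'‖ := by ring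
      _ ≤ n * ‖M‖ * d := by rw [hs]; gcongr
  have h3 : ‖a' * b'ᵀ * M * (a - a')‖ ≤ n * ‖M‖ * d := by
    refine (prod _ _ _ _).trans ?_
    rw [norm_of_orthogonal ha', norm_of_orthogonal hb']
    rw [hs]
    gcongr
  rw [key, norm_smul, Real.norm_of_nonneg (by norm_num : (0 : ℝ) ≤ 1 / 2)]
  have h4 := norm_sub_le (M * (b - b'))
    ((a - a') * bᵀ * M * a + a' * (b - b')ᵀ * M * a + a' * b'ᵀ * M * (a - a'))
  have h5 := norm_add₃_le (a := (a - a') * bᵀ * M * a) (b := a' * (b - b')ᵀ * M * a)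
    (c := a' * b'ᵀ * M * (a - a'))
  have h6 : 0 ≤ n * ‖M‖ * d := by positivity
  have h7 : 0 ≤ ‖M‖ * d := by positivity
  nlinarith

/-- The reaction of two coupled agents is opposite up to second order in their difference. -/
theorem norm_coupling_add_coupling_le {M a b : Matrix (Fin n) (Fin n) ℝ} (ha : aᵀ * a = 1)
    (hb : bᵀ * b = 1) :
    ‖coupling M a b + coupling M b a‖ ≤ √n * ‖M‖ * ‖b - a‖ ^ 2 := by
  have ha' := mul_eq_one_comm.1 ha
  have hb' := mul_eq_one_comm.1 hb
  -- An exact identity in which each term is quadratic in b - a: the first-order parts cancel by a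
  -- aᵀ = b bᵀ = 1.
  have key : coupling M a b + coupling M b a =
      (1 / 2 : ℝ) • ((b - a) * (b - a)ᵀ * M * b + a * (b - a)ᵀ * M * (b - a)) := by
    simp only [coupling, mul_sub, sub_mul, Matrix.transpose_sub, ← smul_add, ha', hb', one_mul]
    congr 1
    abel
  have h1 : ‖(b - a) * (b - a)ᵀ * M * b‖ ≤ √n * ‖M‖ * ‖b - a‖ ^ 2 := by
    calc ‖(b - a) * (b - a)ᵀ * M * b‖ ≤ ‖b - a‖ * ‖(b - a)ᵀ‖ * ‖M‖ * ‖b‖ := by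
          refine (Matrix.frobenius_norm_mul _ _).trans ?_
          gcongr
          refine (Matrix.frobenius_norm_mul _ _).trans ?_
          gcongr
          exact Matrix.frobenius_norm_mul _ _
      _ = √n * ‖M‖ * ‖b - a‖ ^ 2 := by
          rw [Matrix.frobenius_norm_transpose, norm_of_orthogonal hb]; ring
  have h2 : ‖a * (b - a)ᵀ * M * (b - a)‖ ≤ √n * ‖M‖ * ‖b - a‖ ^ 2 := by
    calc ‖a * (b - a)ᵀ * M * (b - a)‖ ≤ ‖a‖ * ‖(b - a)ᵀ‖ * ‖M‖ * ‖b - a‖ := by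
          refine (Matrix.frobenius_norm_mul _ _).trans ?_
          gcongr
          refine (Matrix.frobenius_norm_mul _ _).trans ?_
          gcongr
          exact Matrix.frobenius_norm_mul _ _
      _ = √n * ‖M‖ * ‖b - a‖ ^ 2 := by
          rw [Matrix.frobenius_norm_transpose, norm_of_orthogonal ha]; ring
  rw [key, norm_smul, Real.norm_of_nonneg (by norm_num : (0 : ℝ) ≤ 1 / 2)]
  have h3 := norm_add_le ((b - a) * (b - a)ᵀ * M * b) (a * (b - a)ᵀ * M * (b - a))
  linarith

/-- Coupling pulls towards the other agent as strongly as the weight allows, up to third order. -/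
theorem le_frobInner_sub_coupling {M a b : Matrix (Fin n) (Fin n) ℝ} (ha : aᵀ * a = 1)
    (hb : bᵀ * b = 1) :
    frobInner (b - a) (M * (b - a)) - √n * ‖M‖ * ‖b - a‖ ^ 3 ≤
      frobInner (b - a) (coupling M a b) := by
  have ha' := mul_eq_one_comm.1 ha
  -- Subtracting aᵀa = 1 from bᵀb = 1 shows that aᵀ(b - a) is skew up to second order. Hence the
  -- second term of the coupling contributes another copy of ⟨e, M e⟩, which cancels the factor 1/2.
  have he : (b - a)ᵀ * a = -(aᵀ * (b - a)) - (b - a)ᵀ * (b - a) := by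
    simp only [mul_sub, sub_mul, Matrix.transpose_sub, ha, hb]
    abel
  rw [coupling_eq_coupling_sub ha']
  set e := b - a
  have h1 : frobInner e (a * eᵀ * M * a) =
      -frobInner e (M * e) - (eᵀ * e * (eᵀ * M * a)).trace := by
    have h2 : eᵀ * (a * eᵀ * M * a) = eᵀ * a * (eᵀ * M * a) := by simp only [mul_assoc]
    have h3 : (aᵀ * e * (eᵀ * M * a)).trace = frobInner e (M * e) := by
      rw [Matrix.trace_mul_comm, show eᵀ * M * a * (aᵀ * e) = eᵀ * M * (a * aᵀ) * e by
        simp only [mul_assoc], ha', mul_one, frobInner, mul_assoc]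
    rw [frobInner, h2, he, sub_mul, neg_mul, Matrix.trace_sub, Matrix.trace_neg, h3]
  have h4 : -(‖e‖ ^ 3 * (√n * ‖M‖)) ≤ (eᵀ * e * (eᵀ * M * a)).trace := by
    have h5 := (abs_le.1 (abs_frobInner_le (eᵀ * e) (eᵀ * M * a))).1
    have h6 : frobInner (eᵀ * e) (eᵀ * M * a) = (eᵀ * e * (eᵀ * M * a)).trace := by
      rw [frobInner, Matrix.transpose_mul, Matrix.transpose_transpose]
    have h7 : ‖eᵀ * e‖ * ‖eᵀ * M * a‖ ≤ ‖e‖ ^ 3 * (√n * ‖M‖) := by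
      calc ‖eᵀ * e‖ * ‖eᵀ * M * a‖ ≤ (‖eᵀ‖ * ‖e‖) * (‖eᵀ‖ * ‖M‖ * ‖a‖) := by
            gcongr
            · exact Matrix.frobenius_norm_mul _ _
            · refine (Matrix.frobenius_norm_mul _ _).trans ?_
              gcongr
              exact Matrix.frobenius_norm_mul _ _
        _ = ‖e‖ ^ 3 * (√n * ‖M‖) := by
            rw [Matrix.frobenius_norm_transpose, norm_of_orthogonal ha]; ring
    linarith
  have h8 : 0 ≤ ‖e‖ ^ 3 * (√n * ‖M‖) := by positivity
  rw [coupling, frobInner_smul_right, frobInner_sub_right, h1]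
  linarith

end Algebra

/-! ### Coercivity of positive definite weights -/

section Coercivity

variable {n k : ℕ}

theorem frobInner_mul_eq_sum (M X : Matrix (Fin n) (Fin n) ℝ) :
    frobInner X (M * X) = ∑ c, (fun r => X r c) ⬝ᵥ (M *ᵥ fun r => X r c) := by
  rw [frobInner, Matrix.trace]
  refine Finset.sum_congr rfl fun c _ => ?_
  rw [Matrix.diag_apply, Matrix.mul_apply]
  refine Finset.sum_congr rfl fun r _ => ?_
  rw [Matrix.transpose_apply, Matrix.mul_apply]
  rfl

theorem frobInner_mul_pos {M X : Matrix (Fin n) (Fin n) ℝ} (hM : M.PosDef) (hX : X ≠ 0) :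
    0 < frobInner X (M * X) := by
  have hpos := (Matrix.posDef_iff_dotProduct_mulVec.1 hM).2
  rw [frobInner_mul_eq_sum]
  have hnn : ∀ c, 0 ≤ (fun r => X r c) ⬝ᵥ (M *ᵥ fun r => X r c) := by
    intro c
    by_cases hc : (fun r => X r c) = 0
    · simp [hc]
    · have := hpos hc
      rw [star_trivial] at this
      exact this.le
  have hex : ∃ c, (fun r => X r c) ≠ 0 := by
    by_contra h
    push Not at h
    exact hX (Matrix.ext fun r c => congrFun (h c) r)
  obtain ⟨c, hc⟩ := hex
  refine Finset.sum_pos' (fun c _ => hnn c) ⟨c, Finset.mem_univ _, ?_⟩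
  have := hpos hc
  rwa [star_trivial] at this

theorem exists_coercive {M : Matrix (Fin n) (Fin n) ℝ} (hM : M.PosDef) :
    ∃ l > (0 : ℝ), ∀ X, l * ‖X‖ ^ 2 ≤ frobInner X (M * X) := by
  have hcont : Continuous fun X : Matrix (Fin n) (Fin n) ℝ => frobInner X (M * X) := by
    unfold frobInner
    fun_prop
  have : ProperSpace (Matrix (Fin n) (Fin n) ℝ) := FiniteDimensional.proper ℝ _
  by_cases hne : (Metric.sphere (0 : Matrix (Fin n) (Fin n) ℝ) 1).Nonempty
  · obtain ⟨X₀, hX₀, hmin⟩ := (isCompact_sphere (0 : Matrix (Fin n) (Fin n) ℝ) 1).exists_isMinOn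
      hne hcont.continuousOn
    have hX₀' : X₀ ≠ 0 := by
      rintro rfl
      simp at hX₀
    refine ⟨_, frobInner_mul_pos hM hX₀', fun X => ?_⟩
    by_cases hX : X = 0
    · simp [hX, frobInner]
    have hn : ‖X‖ ≠ 0 := norm_ne_zero_iff.2 hX
    have hmem : ‖X‖⁻¹ • X ∈ Metric.sphere (0 : Matrix (Fin n) (Fin n) ℝ) 1 := by
      rw [mem_sphere_zero_iff_norm, norm_smul, norm_inv, norm_norm, inv_mul_cancel₀ hn]
    have h := hmin hmem
    simp only [Set.mem_ofPred_eq, Matrix.mul_smul, frobInner_smul_left, frobInner_smul_right] at h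
    calc _ ≤ (‖X‖⁻¹ * (‖X‖⁻¹ * frobInner X (M * X))) * ‖X‖ ^ 2 := by gcongr
      _ = frobInner X (M * X) := by field_simp
  -- The unit sphere is empty, so the space is trivial and any constant works.
  · refine ⟨1, one_pos, fun X => ?_⟩
    by_cases hX : X = 0
    · simp [hX, frobInner]
    refine absurd ⟨‖X‖⁻¹ • X, ?_⟩ hne
    rw [mem_sphere_zero_iff_norm, norm_smul, norm_inv, norm_norm,
      inv_mul_cancel₀ (norm_ne_zero_iff.2 hX)]

/-- For each index all sufficiently small positive constants work, and finitely many such conditions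
hold together. -/
theorem exists_uniform_coercive {ι : Type*} [Finite ι] (p : ι → Prop)
    {M : ι → Matrix (Fin n) (Fin n) ℝ} (hM : ∀ i, p i → (M i).PosDef) :
    ∃ l > (0 : ℝ), ∀ i, p i → ∀ X, l * ‖X‖ ^ 2 ≤ frobInner X (M i * X) := by
  have h : ∀ᶠ l : ℝ in 𝓝[>] 0, ∀ i, p i → ∀ X, l * ‖X‖ ^ 2 ≤ frobInner X (M i * X) := by
    refine eventually_all.2 fun i => ?_
    by_cases hi : p i
    · obtain ⟨l, hl, hl'⟩ := exists_coercive (hM i hi)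
      filter_upwards [Ioc_mem_nhdsGT hl] with x hx _ X
      exact (mul_le_mul_of_nonneg_right hx.2 (by positivity)).trans (hl' X)
    · exact Eventually.of_forall fun _ h => absurd h hi
  obtain ⟨l, hl, hl'⟩ := (h.and self_mem_nhdsWithin).exists
  exact ⟨l, hl', hl⟩

end Coercivity

/-! ### Disagreement controlled by the edges of a connected graph -/

section Graph

variable {n k : ℕ}

/-- The sum of the squared distances between all pairs of agents. -/
def disagreement (Q : Fin k → Matrix (Fin n) (Fin n) ℝ) : ℝ := ∑ i, ∑ j, ‖Q i - Q j‖ ^ 2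

theorem disagreement_nonneg (Q : Fin k → Matrix (Fin n) (Fin n) ℝ) : 0 ≤ disagreement Q :=
  Finset.sum_nonneg fun i _ => Finset.sum_nonneg fun j _ => by positivity

theorem norm_sub_le_sqrt_disagreement (Q : Fin k → Matrix (Fin n) (Fin n) ℝ) (i j : Fin k) :
    ‖Q i - Q j‖ ≤ √(disagreement Q) := by
  refine Real.le_sqrt_of_sq_le ?_
  calc ‖Q i - Q j‖ ^ 2 ≤ ∑ j, ‖Q i - Q j‖ ^ 2 :=
        Finset.single_le_sum (f := fun j => ‖Q i - Q j‖ ^ 2) (fun j _ => by positivity)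
          (Finset.mem_univ j)
    _ ≤ disagreement Q :=
        Finset.single_le_sum (f := fun i => ∑ j, ‖Q i - Q j‖ ^ 2)
          (fun i _ => Finset.sum_nonneg fun j _ => by positivity) (Finset.mem_univ i)

/-- The sum of the squared distances between adjacent agents. -/
def edgeEnergy (G : SimpleGraph (Fin k)) [DecidableRel G.Adj]
    (Q : Fin k → Matrix (Fin n) (Fin n) ℝ) : ℝ :=
  ∑ i, ∑ j, if G.Adj i j then ‖Q j - Q i‖ ^ 2 else 0

theorem edgeEnergy_nonneg (G : SimpleGraph (Fin k)) [DecidableRel G.Adj]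
    (Q : Fin k → Matrix (Fin n) (Fin n) ℝ) : 0 ≤ edgeEnergy G Q :=
  Finset.sum_nonneg fun i _ => Finset.sum_nonneg fun j _ => by positivity

theorem norm_sub_le_sqrt_edgeEnergy {G : SimpleGraph (Fin k)} [DecidableRel G.Adj]
    (Q : Fin k → Matrix (Fin n) (Fin n) ℝ) {i j : Fin k} (h : G.Adj i j) :
    ‖Q i - Q j‖ ≤ √(edgeEnergy G Q) := by
  refine Real.le_sqrt_of_sq_le ?_
  calc ‖Q i - Q j‖ ^ 2 = if G.Adj i j then ‖Q j - Q i‖ ^ 2 else 0 := by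
        rw [if_pos h, norm_sub_rev]
    _ ≤ ∑ j, if G.Adj i j then ‖Q j - Q i‖ ^ 2 else 0 :=
        Finset.single_le_sum (f := fun j => if G.Adj i j then ‖Q j - Q i‖ ^ 2 else 0)
          (fun j _ => by positivity) (Finset.mem_univ j)
    _ ≤ edgeEnergy G Q :=
        Finset.single_le_sum (f := fun i => ∑ j, if G.Adj i j then ‖Q j - Q i‖ ^ 2 else 0)
          (fun i _ => Finset.sum_nonneg fun j _ => by positivity) (Finset.mem_univ i)

theorem norm_sub_le_length_mul {G : SimpleGraph (Fin k)} [DecidableRel G.Adj]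
    (Q : Fin k → Matrix (Fin n) (Fin n) ℝ) {i j : Fin k} (p : G.Walk i j) :
    ‖Q i - Q j‖ ≤ p.length * √(edgeEnergy G Q) := by
  induction p with
  | nil => simp
  | @cons u v w h p ih =>
    have h1 := norm_sub_le_sqrt_edgeEnergy Q h
    have h2 := norm_sub_le_norm_sub_add_norm_sub (Q u) (Q v) (Q w)
    rw [SimpleGraph.Walk.length_cons]
    push_cast
    linarith

/-- Any two agents are joined by a path of fewer than k edges, each of length at most the root of
the edge energy. Squaring gives k², and the k² ordered pairs give the rest. -/
theorem disagreement_le_mul_edgeEnergy {G : SimpleGraph (Fin k)} [DecidableRel G.Adj]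
    (hG : G.Connected) (Q : Fin k → Matrix (Fin n) (Fin n) ℝ) :
    disagreement Q ≤ (k : ℝ) ^ 4 * edgeEnergy G Q := by
  have h : ∀ i j, ‖Q i - Q j‖ ^ 2 ≤ (k : ℝ) ^ 2 * edgeEnergy G Q := by
    intro i j
    obtain ⟨p, hp⟩ := (hG.preconnected i j).exists_isPath
    have h1 := norm_sub_le_length_mul Q p
    have h2 : (p.length : ℝ) ≤ k := by
      have := hp.length_lt
      rw [Fintype.card_fin] at this
      exact_mod_cast this.le
    calc ‖Q i - Q j‖ ^ 2 ≤ (k * √(edgeEnergy G Q)) ^ 2 := by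
          refine pow_le_pow_left₀ (norm_nonneg _) (h1.trans ?_) 2
          gcongr
      _ = (k : ℝ) ^ 2 * edgeEnergy G Q := by
          rw [mul_pow, Real.sq_sqrt (edgeEnergy_nonneg G Q)]
  calc disagreement Q ≤ ∑ _i : Fin k, ∑ _j : Fin k, (k : ℝ) ^ 2 * edgeEnergy G Q :=
        Finset.sum_le_sum fun i _ => Finset.sum_le_sum fun j _ => h i j
    _ = (k : ℝ) ^ 4 * edgeEnergy G Q := by
        simp only [Finset.sum_const, Finset.card_univ, Fintype.card_fin, nsmul_eq_mul]
        ring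

end Graph

/-! ### Dissipation of the disagreement by the averaged field -/

section Dissipation

variable {n k : ℕ}

/-- The coupling field on the agents with the given family of weights. -/
def couplingField (A : Fin k → Fin k → Matrix (Fin n) (Fin n) ℝ)
    (Q : Fin k → Matrix (Fin n) (Fin n) ℝ) (i : Fin k) : Matrix (Fin n) (Fin n) ℝ :=
  ∑ j, coupling (A i j) (Q i) (Q j)

/-- The sum of the displacements of all agents from agent `i`. -/
def totalOffset (Q : Fin k → Matrix (Fin n) (Fin n) ℝ) (i : Fin k) : Matrix (Fin n) (Fin n) ℝ :=
  ∑ l, (Q i - Q l)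

theorem totalOffset_eq_add (Q : Fin k → Matrix (Fin n) (Fin n) ℝ) (i j : Fin k) :
    totalOffset Q i = totalOffset Q j - (k : ℝ) • (Q j - Q i) := by
  simp only [totalOffset, Finset.sum_sub_distrib, Finset.sum_const, Finset.card_univ,
    Fintype.card_fin, smul_sub, Nat.cast_smul_eq_nsmul]
  abel

theorem norm_totalOffset_le (Q : Fin k → Matrix (Fin n) (Fin n) ℝ) (i : Fin k) :
    ‖totalOffset Q i‖ ≤ k * √(disagreement Q) := by
  refine (norm_sum_le _ _).trans ?_
  calc ∑ l, ‖Q i - Q l‖ ≤ ∑ _l : Fin k, √(disagreement Q) :=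
        Finset.sum_le_sum fun l _ => norm_sub_le_sqrt_disagreement Q i l
    _ = k * √(disagreement Q) := by simp

/-- The left side is half the derivative of the disagreement in the direction `F`; the right side
expresses it through one field value per agent. -/
theorem sum_frobInner_sub_sub_eq (Q F : Fin k → Matrix (Fin n) (Fin n) ℝ) :
    ∑ i, ∑ j, frobInner (Q i - Q j) (F i - F j) = 2 * ∑ i, frobInner (totalOffset Q i) (F i) := by
  have h1 : ∑ i, ∑ j, frobInner (Q i - Q j) (F i) = ∑ i, frobInner (totalOffset Q i) (F i) :=
    Finset.sum_congr rfl fun i _ => by rw [totalOffset, frobInner_sum_left]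
  have h2 : ∑ i, ∑ j, frobInner (Q i - Q j) (F j) = -∑ i, frobInner (totalOffset Q i) (F i) := by
    rw [← h1, Finset.sum_comm, ← Finset.sum_neg_distrib]
    refine Finset.sum_congr rfl fun i _ => ?_
    rw [← Finset.sum_neg_distrib]
    refine Finset.sum_congr rfl fun j _ => ?_
    rw [frobInner_sub_left, frobInner_sub_left]
    ring
  simp only [frobInner_sub_right, Finset.sum_sub_distrib]
  rw [h1, h2]
  ring

/-- Pairing the contributions of (i, j) and (j, i) isolates the sum of the two opposite couplings,
which is of second order. The two offsets differ by k(Q_j - Q_i), and this leaves the dissipative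
term. -/
theorem sum_frobInner_couplingField_eq (A : Fin k → Fin k → Matrix (Fin n) (Fin n) ℝ)
    (hA : ∀ i j, A i j = A j i) (Q : Fin k → Matrix (Fin n) (Fin n) ℝ) :
    ∑ i, ∑ j, frobInner (Q i - Q j) (couplingField A Q i - couplingField A Q j) =
      ∑ i, ∑ j, (frobInner (totalOffset Q j)
          (coupling (A i j) (Q i) (Q j) + coupling (A i j) (Q j) (Q i)) -
        k * frobInner (Q j - Q i) (coupling (A i j) (Q i) (Q j))) := by
  have h1 : ∑ i, frobInner (totalOffset Q i) (couplingField A Q i) =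
      ∑ i, ∑ j, frobInner (totalOffset Q i) (coupling (A i j) (Q i) (Q j)) :=
    Finset.sum_congr rfl fun i _ => by rw [couplingField, frobInner_sum_right]
  have h2 : ∑ i, frobInner (totalOffset Q i) (couplingField A Q i) =
      ∑ i, ∑ j, frobInner (totalOffset Q j) (coupling (A i j) (Q j) (Q i)) := by
    rw [h1, Finset.sum_comm]
    refine Finset.sum_congr rfl fun i _ => Finset.sum_congr rfl fun j _ => ?_
    rw [hA j i]
  rw [sum_frobInner_sub_sub_eq, two_mul]
  nth_rewrite 1 [h1]
  rw [h2, ← Finset.sum_add_distrib]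
  refine Finset.sum_congr rfl fun i _ => ?_
  rw [← Finset.sum_add_distrib]
  refine Finset.sum_congr rfl fun j _ => ?_
  rw [totalOffset_eq_add Q i j, frobInner_sub_left, frobInner_smul_left, frobInner_add_right]
  ring

/-- Estimate for one edge, used with κ = k and ρ = √V. There are two cubic errors, each at most κ √n
B ρ ‖b - a‖²; by `hρ` they consume at most half of the coercivity constant. -/
theorem frobInner_coupling_add_sub_le {M a b w : Matrix (Fin n) (Fin n) ℝ} {l B ρ κ : ℝ}
    (ha : aᵀ * a = 1) (hb : bᵀ * b = 1) (hM : ‖M‖ ≤ B)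
    (hco : l * ‖b - a‖ ^ 2 ≤ frobInner (b - a) (M * (b - a))) (hs : ‖b - a‖ ≤ ρ) (hκ : 0 ≤ κ)
    (hw : ‖w‖ ≤ κ * ρ) (hρ : 2 * (√n * B) * ρ ≤ l / 2) :
    frobInner w (coupling M a b + coupling M b a) - κ * frobInner (b - a) (coupling M a b) ≤
      -(κ * (l / 2)) * ‖b - a‖ ^ 2 := by
  have h3 := frobInner_le w (coupling M a b + coupling M b a)
  have h3' := norm_coupling_add_coupling_le (M := M) ha hb
  have h4 := le_frobInner_sub_coupling (M := M) ha hb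
  generalize frobInner (b - a) (coupling M a b) = u at *
  generalize frobInner w (coupling M a b + coupling M b a) = v at *
  generalize frobInner (b - a) (M * (b - a)) = x at *
  generalize ‖coupling M a b + coupling M b a‖ = z at *
  have hs0 : 0 ≤ ‖b - a‖ := norm_nonneg _
  have hw0 : 0 ≤ ‖w‖ := norm_nonneg _
  have hM0 : 0 ≤ ‖M‖ := norm_nonneg _
  generalize ‖b - a‖ = s at *
  generalize ‖w‖ = q at *
  generalize ‖M‖ = m at *
  have hn0 : 0 ≤ √(n : ℝ) := Real.sqrt_nonneg _
  generalize √(n : ℝ) = r at *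
  have hρ0 : 0 ≤ ρ := hs0.trans hs
  have h1 : r * m * s ^ 2 ≤ r * B * s ^ 2 := by gcongr
  have h2 : r * m * s ^ 3 ≤ r * B * ρ * s ^ 2 := by
    calc r * m * s ^ 3 = r * m * s * s ^ 2 := by ring
      _ ≤ r * B * ρ * s ^ 2 := by
        have : 0 ≤ B := hM0.trans hM
        gcongr
  have h5 : v ≤ κ * ρ * (r * B * s ^ 2) :=
    calc v ≤ q * z := h3
      _ ≤ q * (r * B * s ^ 2) := mul_le_mul_of_nonneg_left (h3'.trans h1) hw0
      _ ≤ κ * ρ * (r * B * s ^ 2) := by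
        have : 0 ≤ B := hM0.trans hM
        gcongr
  have h6 : l * s ^ 2 - r * B * ρ * s ^ 2 ≤ u := by linarith
  have h7 := mul_le_mul_of_nonneg_left h6 hκ
  have h8 : κ * s ^ 2 * (2 * (r * B) * ρ) ≤ κ * s ^ 2 * (l / 2) := by gcongr
  linarith

/-- Near synchronization, coercive coupling along the edges of a connected graph dissipates the
disagreement. -/
theorem exists_dissipation {G : SimpleGraph (Fin k)} [DecidableRel G.Adj] (hG : G.Connected)
    {A : Fin k → Fin k → Matrix (Fin n) (Fin n) ℝ} (hsymm : ∀ i j, A i j = A j i)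
    (hoff : ∀ i j, ¬G.Adj i j → A i j = 0) {l : ℝ} (hl : 0 < l)
    (hco : ∀ i j, G.Adj i j → ∀ X, l * ‖X‖ ^ 2 ≤ frobInner X (A i j * X)) :
    ∃ c > (0 : ℝ), ∃ δ > (0 : ℝ), ∀ Q : Fin k → Matrix (Fin n) (Fin n) ℝ,
      (∀ i, (Q i)ᵀ * Q i = 1) → √(disagreement Q) ≤ δ →
      ∑ i, ∑ j, frobInner (Q i - Q j) (couplingField A Q i - couplingField A Q j) ≤
        -c * disagreement Q := by
  have := hG.nonempty
  have hk : 0 < k := Fin.pos_iff_nonempty.2 inferInstance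
  have hk' : (0 : ℝ) < k := Nat.cast_pos.2 hk
  set B : ℝ := ∑ i, ∑ j, ‖A i j‖ with hBdef
  have hB : ∀ i j, ‖A i j‖ ≤ B := fun i j =>
    (Finset.single_le_sum (f := fun j => ‖A i j‖) (fun j _ => norm_nonneg _)
      (Finset.mem_univ j)).trans
      (Finset.single_le_sum (f := fun i => ∑ j, ‖A i j‖)
        (fun i _ => Finset.sum_nonneg fun j _ => norm_nonneg _) (Finset.mem_univ i))
  have hB0 : 0 ≤ B := Finset.sum_nonneg fun i _ => Finset.sum_nonneg fun j _ => norm_nonneg _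
  have hD : 0 < 4 * (√n * B + 1) := by positivity
  -- The rate is the edge rate k l/2 divided by the constant k⁴ of the graph inequality. The radius
  -- makes 2√n B ρ ≤ l/2, and the +1 avoids division by zero when B = 0.
  refine ⟨(k * (l / 2)) / (k : ℝ) ^ 4, by positivity, l / (4 * (√n * B + 1)), by positivity,
    fun Q hQ hδ => ?_⟩
  set ρ := √(disagreement Q)
  have hρ0 : 0 ≤ ρ := Real.sqrt_nonneg _
  have hρ : 2 * (√n * B) * ρ ≤ l / 2 := by
    have h1 : ρ * (4 * (√n * B + 1)) ≤ l := (le_div_iff₀ hD).1 hδ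
    nlinarith
  have hterm : ∀ i j, frobInner (totalOffset Q j)
          (coupling (A i j) (Q i) (Q j) + coupling (A i j) (Q j) (Q i)) -
        k * frobInner (Q j - Q i) (coupling (A i j) (Q i) (Q j)) ≤
      -(k * (l / 2)) * if G.Adj i j then ‖Q j - Q i‖ ^ 2 else 0 := by
    intro i j
    by_cases hij : G.Adj i j
    · rw [if_pos hij]
      exact frobInner_coupling_add_sub_le (hQ i) (hQ j) (hB i j) (hco i j hij _)
        (norm_sub_le_sqrt_disagreement Q j i) hk'.le (norm_totalOffset_le Q j) hρ
    · rw [if_neg hij, hoff i j hij, coupling_zero, coupling_zero]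
      simp [frobInner]
  rw [sum_frobInner_couplingField_eq A hsymm]
  calc _ ≤ ∑ i, ∑ j, -(k * (l / 2)) * (if G.Adj i j then ‖Q j - Q i‖ ^ 2 else 0) :=
        Finset.sum_le_sum fun i _ => Finset.sum_le_sum fun j _ => hterm i j
    _ = -(k * (l / 2)) * edgeEnergy G Q := by
        simp only [edgeEnergy, Finset.mul_sum]
    _ ≤ -(k * (l / 2) / (k : ℝ) ^ 4) * disagreement Q := by
        have h := disagreement_le_mul_edgeEnergy hG Q
        have h2 : k * (l / 2) / (k : ℝ) ^ 4 * disagreement Q ≤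
            k * (l / 2) / (k : ℝ) ^ 4 * ((k : ℝ) ^ 4 * edgeEnergy G Q) := by gcongr
        have h3 : k * (l / 2) / (k : ℝ) ^ 4 * ((k : ℝ) ^ 4 * edgeEnergy G Q) =
            k * (l / 2) * edgeEnergy G Q := by field_simp
        linarith

end Dissipation

/-! ### First-order averaging over one window -/

section Averaging

/-- First-order averaging over one window: a trajectory of `x' = ε v` follows a primitive of the
field `w` frozen at the initial state up to second order in `ε`. -/
theorem averaging_estimate {E : Type*} [NormedAddCommGroup E] [NormedSpace ℝ E]
    {x Φ v w : ℝ → E} {a b ε C ρ : ℝ} (hab : a ≤ b) (hε : 0 < ε) (hC : 0 < C) (hρ : 0 ≤ ρ)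
    (hx : ∀ t ∈ Set.Icc a b, HasDerivWithinAt x (ε • v t) (Set.Icc a b) t)
    (hΦ : ∀ t ∈ Set.Icc a b, HasDerivWithinAt Φ (w t) (Set.Icc a b) t)
    (hvw : ∀ t ∈ Set.Icc a b, ‖v t - w t‖ ≤ C * ‖x t - x a‖)
    (hw : ∀ t ∈ Set.Icc a b, ‖w t‖ ≤ C * ρ) (hsmall : C * ε * (b - a) ≤ 1) :
    (∀ t ∈ Set.Icc a b, ‖x t - x a‖ ≤ 2 * (C * ε * (b - a)) * ρ) ∧
      ‖x b - x a - ε • (Φ b - Φ a)‖ ≤ 2 * (C * ε * (b - a)) ^ 2 * ρ := by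
  have hCε : 0 < C * ε := mul_pos hC hε
  have hgrowth : ∀ t ∈ Set.Icc a b, ‖x t - x a‖ ≤ 2 * (C * ε * (b - a)) * ρ := by
    intro t ht
    -- Grönwall gives ρ(exp(Cε(t - a)) - 1), and `hsmall` allows exp(u) - 1 ≤ 2u.
    have h := norm_le_gronwallBound_of_norm_deriv_right_le (f := fun t => x t - x a)
      (f' := fun t => ε • v t) (δ := 0) (K := C * ε) (ε := C * ε * ρ) (a := a) (b := b)
      (fun t ht => ((hx t ht).sub_const (x a)).continuousWithinAt)
      (fun t ht => ((hx t (Set.Ico_subset_Icc_self ht)).sub_const (x a)).mono_of_mem_nhdsWithin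
        (Icc_mem_nhdsGE_of_mem ht)) (by simp)
      (fun t ht => by
        have h1 := hvw t (Set.Ico_subset_Icc_self ht)
        have h2 := hw t (Set.Ico_subset_Icc_self ht)
        have h3 := norm_sub_norm_le (v t) (w t)
        rw [norm_smul, Real.norm_of_nonneg hε.le]
        calc ε * ‖v t‖ ≤ ε * (C * ‖x t - x a‖ + C * ρ) := by gcongr; linarith
          _ = C * ε * ‖x t - x a‖ + C * ε * ρ := by ring) t ht
    rw [gronwallBound_of_K_ne_0 hCε.ne'] at h
    have ht0 : 0 ≤ t - a := sub_nonneg.2 ht.1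
    have ht1 : C * ε * (t - a) ≤ C * ε * (b - a) := by
      gcongr
      exact ht.2
    have he := Real.abs_exp_sub_one_le (x := C * ε * (t - a))
      (by rw [abs_of_nonneg (by positivity)]; linarith)
    rw [abs_of_nonneg (by positivity : 0 ≤ C * ε * (t - a))] at he
    have he' := (le_abs_self _).trans he
    calc ‖x t - x a‖ ≤ 0 * Real.exp (C * ε * (t - a)) +
          C * ε * ρ / (C * ε) * (Real.exp (C * ε * (t - a)) - 1) := h
      _ = ρ * (Real.exp (C * ε * (t - a)) - 1) := by
          rw [mul_div_cancel_left₀ _ hCε.ne']; ring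
      _ ≤ ρ * (2 * (C * ε * (b - a))) := by gcongr; linarith
      _ = 2 * (C * ε * (b - a)) * ρ := by ring
  refine ⟨hgrowth, ?_⟩
  -- The derivative of x - εΦ is ε(v - w), which the growth bound just proved makes of second order
  -- in ε.
  have h := norm_image_sub_le_of_norm_deriv_le_segment' (f := fun t => x t - ε • Φ t)
    (f' := fun t => ε • v t - ε • w t) (C := C * ε * (2 * (C * ε * (b - a)) * ρ))
    (fun t ht => (hx t ht).sub ((hΦ t ht).const_smul ε))
    (fun t ht => by
      have ht' := Set.Ico_subset_Icc_self ht
      rw [← smul_sub, norm_smul, Real.norm_of_nonneg hε.le]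
      calc ε * ‖v t - w t‖ ≤ ε * (C * (2 * (C * ε * (b - a)) * ρ)) :=
            mul_le_mul_of_nonneg_left ((hvw t ht').trans
              (mul_le_mul_of_nonneg_left (hgrowth t ht') hC.le)) hε.le
        _ = C * ε * (2 * (C * ε * (b - a)) * ρ) := by ring) b (Set.right_mem_Icc.2 hab)
  calc ‖x b - x a - ε • (Φ b - Φ a)‖ = ‖x b - ε • Φ b - (x a - ε • Φ a)‖ := by
        congr 1
        rw [smul_sub]
        abel
    _ ≤ _ := h
    _ = 2 * (C * ε * (b - a)) ^ 2 * ρ := by ring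

end Averaging

/-! ### From window contraction to exponential decay -/

section Decay

/-- Contraction over windows of fixed length, together with bounded growth inside a window, gives
exponential decay. -/
theorem exp_decay_of_window_contraction {g : ℝ → ℝ} {t₀ t₁ T μ K δ : ℝ} (hT : 0 < T)
    (hμ : 0 ≤ μ) (hK : 0 ≤ K) (hg : ∀ t, 0 ≤ g t)
    (hstep : ∀ a, t₀ ≤ a → a + T ≤ t₁ → √(g a) ≤ δ → g (a + T) ≤ Real.exp (-μ * T) * g a)
    (hgrowth : ∀ a t, t₀ ≤ a → a ≤ t → t ≤ t₁ → t ≤ a + T → g t ≤ K * g a)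
    (h0 : √(g t₀) ≤ δ) {t : ℝ} (ht : t ∈ Set.Icc t₀ t₁) :
    g t ≤ K * Real.exp (μ * T) * Real.exp (-μ * (t - t₀)) * g t₀ := by
  have hiter : ∀ m : ℕ, t₀ + m * T ≤ t₁ →
      g (t₀ + m * T) ≤ Real.exp (-μ * (m * T)) * g t₀ := by
    intro m
    induction m with
    | zero => intro _; simp
    | succ m ih =>
      intro hm
      push_cast at hm ⊢
      have hm0 : (0 : ℝ) ≤ m * T := by positivity
      have hm' := ih (by linarith)
      have hle : g (t₀ + m * T) ≤ g t₀ := by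
        refine hm'.trans (mul_le_of_le_one_left (hg _) (Real.exp_le_one_iff.2 ?_))
        have := mul_nonneg hμ hm0
        linarith
      have hs := hstep (t₀ + m * T) (by linarith) (by linarith)
        ((Real.sqrt_le_sqrt hle).trans h0)
      calc g (t₀ + (m + 1) * T) = g (t₀ + m * T + T) := by congr 1; ring
        _ ≤ Real.exp (-μ * T) * (Real.exp (-μ * (m * T)) * g t₀) := hs.trans (by gcongr)
        _ = Real.exp (-μ * ((m + 1) * T)) * g t₀ := by
          rw [← mul_assoc, ← Real.exp_add]
          congr 2
          ring
  have htt : 0 ≤ (t - t₀) / T := div_nonneg (sub_nonneg.2 ht.1) hT.le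
  have hf1 : (⌊(t - t₀) / T⌋₊ : ℝ) * T ≤ t - t₀ := (le_div_iff₀ hT).1 (Nat.floor_le htt)
  have hf2 : t - t₀ < (⌊(t - t₀) / T⌋₊ + 1) * T := (div_lt_iff₀ hT).1 (Nat.lt_floor_add_one _)
  set m := ⌊(t - t₀) / T⌋₊
  have hm0 : (0 : ℝ) ≤ m * T := by positivity
  have hm := hiter m (by linarith [ht.2])
  calc g t ≤ K * g (t₀ + m * T) :=
        hgrowth _ _ (by linarith) (by linarith) ht.2 (by linarith)
    -- The m complete windows cover more than t - t₀ - T, so the incomplete last one costs the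
    -- factor exp(μT).
    _ ≤ K * (Real.exp (μ * T + -μ * (t - t₀)) * g t₀) := by
        gcongr
        refine hm.trans ?_
        gcongr
        · exact hg _
        · nlinarith
    _ = K * Real.exp (μ * T) * Real.exp (-μ * (t - t₀)) * g t₀ := by
        rw [Real.exp_add]
        ring

end Decay

/-! ### Evolution of the disagreement over one window -/

section Window

variable {n k : ℕ}

/-- Serves twice: with `m = 1` for the field itself and with `m = z` for the averaging defect. The
norm on k-tuples is the supremum norm. -/
theorem norm_couplingField_le {M : Fin k → Fin k → Matrix (Fin n) (Fin n) ℝ}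
    {Q : Fin k → Matrix (Fin n) (Fin n) ℝ} {m : ℝ} (hm : 0 ≤ m) (hM : ∀ i j, ‖M i j‖ ≤ m)
    (hQ : ∀ i, (Q i)ᵀ * Q i = 1) :
    ‖couplingField M Q‖ ≤ k * (1 + n) * m * √(disagreement Q) := by
  refine (pi_norm_le_iff_of_nonneg (by positivity)).2 fun i => ?_
  calc ‖couplingField M Q i‖ ≤ ∑ j, ‖coupling (M i j) (Q i) (Q j)‖ := norm_sum_le _ _
    _ ≤ ∑ _j : Fin k, (1 + n) * m * √(disagreement Q) :=
        Finset.sum_le_sum fun j _ => (norm_coupling_le (hQ i)).trans (by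
          gcongr
          · exact hM i j
          · exact norm_sub_le_sqrt_disagreement Q j i)
    _ = k * (1 + n) * m * √(disagreement Q) := by
        simp only [Finset.sum_const, Finset.card_univ, Fintype.card_fin, nsmul_eq_mul]
        ring

theorem norm_couplingField_sub_le {M : Fin k → Fin k → Matrix (Fin n) (Fin n) ℝ}
    {Q Q' : Fin k → Matrix (Fin n) (Fin n) ℝ} (hM : ∀ i j, ‖M i j‖ ≤ 1)
    (hQ : ∀ i, (Q i)ᵀ * Q i = 1) (hQ' : ∀ i, (Q' i)ᵀ * Q' i = 1) :
    ‖couplingField M Q - couplingField M Q'‖ ≤ 2 * k * (1 + n) * ‖Q - Q'‖ := by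
  refine (pi_norm_le_iff_of_nonneg (by positivity)).2 fun i => ?_
  rw [Pi.sub_apply, couplingField, couplingField, ← Finset.sum_sub_distrib]
  calc _ ≤ ∑ j, ‖coupling (M i j) (Q i) (Q j) - coupling (M i j) (Q' i) (Q' j)‖ :=
        norm_sum_le _ _
    _ ≤ ∑ _j : Fin k, 2 * (1 + n) * 1 * ‖Q - Q'‖ :=
        Finset.sum_le_sum fun j _ => (norm_coupling_sub_le (hQ i) (hQ j) (hQ' i) (hQ' j)
          (norm_le_pi_norm (Q - Q') i) (norm_le_pi_norm (Q - Q') j)).trans (by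
            gcongr
            exact hM i j)
    _ = 2 * k * (1 + n) * ‖Q - Q'‖ := by
        simp only [Finset.sum_const, Finset.card_univ, Fintype.card_fin, nsmul_eq_mul]
        ring

/-- Linearity in the weights: with the state frozen, integrating the field in time amounts to
integrating the weights. -/
theorem hasDerivAt_couplingField {M : ℝ → Fin k → Fin k → Matrix (Fin n) (Fin n) ℝ}
    {M' : Fin k → Fin k → Matrix (Fin n) (Fin n) ℝ} {t : ℝ}
    (hM : ∀ i j, HasDerivAt (fun s => M s i j) (M' i j) t)
    (Q : Fin k → Matrix (Fin n) (Fin n) ℝ) :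
    HasDerivAt (fun s => couplingField (M s) Q) (couplingField M' Q) t := by
  refine hasDerivAt_pi.2 fun i => ?_
  simp only [couplingField]
  refine HasDerivAt.fun_sum fun j _ => ?_
  simp only [coupling]
  exact (((hM i j).mul_const (Q j)).sub
    (((hM i j).const_mul (Q i * (Q j)ᵀ)).mul_const (Q i))).const_smul (1 / 2 : ℝ)

theorem couplingField_sub_smul (M A : Fin k → Fin k → Matrix (Fin n) (Fin n) ℝ) (τ : ℝ)
    (Q : Fin k → Matrix (Fin n) (Fin n) ℝ) :
    couplingField (fun i j => M i j - τ • A i j) Q =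
      couplingField M Q - τ • couplingField A Q := by
  funext i
  simp only [couplingField, coupling_sub_weight, coupling_smul_weight, Finset.sum_sub_distrib,
    Pi.sub_apply, Pi.smul_apply, Finset.smul_sum]

/-- An increment close to a multiple of a dissipating field decreases the disagreement. -/
theorem disagreement_le_of_increment {Q Q' F : Fin k → Matrix (Fin n) (Fin n) ℝ} {c τ p q : ℝ}
    (hτ : 0 ≤ τ)
    (hF : ∑ i, ∑ j, frobInner (Q i - Q j) (F i - F j) ≤ -c * disagreement Q)
    (hp : ∀ i, ‖Q' i - Q i‖ ≤ p * √(disagreement Q))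
    (hq : ∀ i, ‖Q' i - Q i - τ • F i‖ ≤ q * √(disagreement Q)) :
    disagreement Q' ≤
      (1 - 2 * τ * c + 4 * (k : ℝ) ^ 2 * q + 4 * (k : ℝ) ^ 2 * p ^ 2) * disagreement Q := by
  have hV : √(disagreement Q) ^ 2 = disagreement Q := Real.sq_sqrt (disagreement_nonneg Q)
  have hρ0 : 0 ≤ √(disagreement Q) := Real.sqrt_nonneg _
  have hterm : ∀ i j, ‖Q' i - Q' j‖ ^ 2 ≤ ‖Q i - Q j‖ ^ 2 +
      (2 * τ) * frobInner (Q i - Q j) (F i - F j) +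
      (4 * q * disagreement Q + 4 * p ^ 2 * disagreement Q) := by
    intro i j
    have h1 : Q' i - Q' j = (Q i - Q j) + ((Q' i - Q i) - (Q' j - Q j)) := by abel
    have h2 : (Q' i - Q i) - (Q' j - Q j) =
        τ • (F i - F j) + ((Q' i - Q i - τ • F i) - (Q' j - Q j - τ • F j)) := by
      rw [smul_sub]
      abel
    have h3 : frobInner (Q i - Q j) ((Q' i - Q i - τ • F i) - (Q' j - Q j - τ • F j)) ≤
        2 * q * disagreement Q := by
      calc _ ≤ ‖Q i - Q j‖ * ‖(Q' i - Q i - τ • F i) - (Q' j - Q j - τ • F j)‖ :=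
            frobInner_le _ _
        _ ≤ √(disagreement Q) * (q * √(disagreement Q) + q * √(disagreement Q)) := by
            gcongr
            · exact norm_sub_le_sqrt_disagreement Q i j
            · exact (norm_sub_le _ _).trans (add_le_add (hq i) (hq j))
        _ = 2 * q * √(disagreement Q) ^ 2 := by ring
        _ = 2 * q * disagreement Q := by rw [hV]
    have h4 : ‖(Q' i - Q i) - (Q' j - Q j)‖ ^ 2 ≤ 4 * p ^ 2 * disagreement Q := by
      calc ‖(Q' i - Q i) - (Q' j - Q j)‖ ^ 2
          ≤ (p * √(disagreement Q) + p * √(disagreement Q)) ^ 2 :=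
            pow_le_pow_left₀ (norm_nonneg _)
              ((norm_sub_le _ _).trans (add_le_add (hp i) (hp j))) 2
        _ = 4 * p ^ 2 * √(disagreement Q) ^ 2 := by ring
        _ = 4 * p ^ 2 * disagreement Q := by rw [hV]
    have h5 : frobInner (Q i - Q j) ((Q' i - Q i) - (Q' j - Q j)) ≤
        τ * frobInner (Q i - Q j) (F i - F j) + 2 * q * disagreement Q := by
      rw [h2, frobInner_add_right, frobInner_smul_right]
      linarith
    rw [h1, norm_add_sq_frob]
    linarith
  calc disagreement Q' ≤ ∑ i, ∑ j, (‖Q i - Q j‖ ^ 2 +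
        (2 * τ) * frobInner (Q i - Q j) (F i - F j) +
        (4 * q * disagreement Q + 4 * p ^ 2 * disagreement Q)) :=
        Finset.sum_le_sum fun i _ => Finset.sum_le_sum fun j _ => hterm i j
    _ = disagreement Q + (2 * τ) * ∑ i, ∑ j, frobInner (Q i - Q j) (F i - F j) +
        (k : ℝ) ^ 2 * (4 * q * disagreement Q + 4 * p ^ 2 * disagreement Q) := by
        simp only [Finset.sum_add_distrib, ← Finset.mul_sum, Finset.sum_const, Finset.card_univ,
          Fintype.card_fin, nsmul_eq_mul]
        simp only [disagreement]
        ring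
    _ ≤ _ := by
        have h := mul_le_mul_of_nonneg_left hF (by positivity : 0 ≤ 2 * τ)
        linarith

theorem disagreement_le_of_norm_sub_le {Q Q' : Fin k → Matrix (Fin n) (Fin n) ℝ}
    (h : ∀ i, ‖Q' i - Q i‖ ≤ 2 * √(disagreement Q)) :
    disagreement Q' ≤ 25 * (k : ℝ) ^ 2 * disagreement Q := by
  have hterm : ∀ i j, ‖Q' i - Q' j‖ ^ 2 ≤ 25 * disagreement Q := by
    intro i j
    have h1 : Q' i - Q' j = (Q i - Q j) + (Q' i - Q i) - (Q' j - Q j) := by abel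
    have h2 : ‖Q' i - Q' j‖ ≤ 5 * √(disagreement Q) := by
      rw [h1]
      have h3 := norm_sub_le ((Q i - Q j) + (Q' i - Q i)) (Q' j - Q j)
      have h4 := norm_add_le (Q i - Q j) (Q' i - Q i)
      have h5 := norm_sub_le_sqrt_disagreement Q i j
      linarith [h i, h j]
    calc ‖Q' i - Q' j‖ ^ 2 ≤ (5 * √(disagreement Q)) ^ 2 :=
          pow_le_pow_left₀ (norm_nonneg _) h2 2
      _ = 25 * disagreement Q := by
          rw [mul_pow, Real.sq_sqrt (disagreement_nonneg Q)]
          norm_num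
  calc disagreement Q' ≤ ∑ _i : Fin k, ∑ _j : Fin k, 25 * disagreement Q :=
        Finset.sum_le_sum fun i _ => Finset.sum_le_sum fun j _ => hterm i j
    _ = 25 * (k : ℝ) ^ 2 * disagreement Q := by
        simp only [Finset.sum_const, Finset.card_univ, Fintype.card_fin, nsmul_eq_mul]
        ring

/-- Over a short window, solutions of the coupled system on the orthogonal group follow the
time-integrated field frozen at the initial state. -/
theorem couplingField_averaging {N : ℝ → Fin k → Fin k → Matrix (Fin n) (Fin n) ℝ}
    (hk : 0 < k) (hcont : ∀ i j, Continuous fun t => N t i j) (hN : ∀ t i j, ‖N t i j‖ ≤ 1)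
    {x : ℝ → Fin k → Matrix (Fin n) (Fin n) ℝ} (hQ : ∀ t i, (x t i)ᵀ * x t i = 1)
    {a b ε : ℝ} (hab : a ≤ b) (hε : 0 < ε)
    (hx : ∀ t ∈ Set.Icc a b,
      HasDerivWithinAt x (ε • couplingField (N t) (x t)) (Set.Icc a b) t)
    (hsmall : 2 * k * (1 + n) * ε * (b - a) ≤ 1) :
    (∀ t ∈ Set.Icc a b,
      ‖x t - x a‖ ≤ 2 * (2 * k * (1 + n) * ε * (b - a)) * √(disagreement (x a))) ∧
    ‖x b - x a - ε • couplingField (fun i j => ∫ s in a..b, N s i j) (x a)‖ ≤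
      2 * (2 * k * (1 + n) * ε * (b - a)) ^ 2 * √(disagreement (x a)) := by
  have hk' : (0 : ℝ) < k := Nat.cast_pos.2 hk
  have hder : ∀ t, HasDerivAt
      (fun t => couplingField (fun i j => ∫ s in a..t, N s i j) (x a))
      (couplingField (N t) (x a)) t := fun t =>
    hasDerivAt_couplingField (fun i j => (hcont i j).integral_hasStrictDerivAt a t |>.hasDerivAt)
      (x a)
  have h0 : couplingField (fun i j => ∫ s in a..a, N s i j) (x a) = 0 := by
    funext i
    simp [couplingField, coupling_zero]
  have h := averaging_estimate (x := x) (v := fun t => couplingField (N t) (x t))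
    (w := fun t => couplingField (N t) (x a)) (C := 2 * k * (1 + n))
    (ρ := √(disagreement (x a))) hab hε (by positivity) (Real.sqrt_nonneg _) hx
    (fun t _ => (hder t).hasDerivWithinAt)
    (fun t _ => norm_couplingField_sub_le (hN t) (hQ t) (hQ a))
    (fun t _ => (norm_couplingField_le zero_le_one (hN t) (hQ a)).trans (by
      have : 0 ≤ k * (1 + n) * √(disagreement (x a)) := by positivity
      linarith)) hsmall
  simp only [h0, sub_zero] at h
  exact h

/-- Contraction of the disagreement over one averaging window. -/
theorem disagreement_window_contraction
    {N : ℝ → Fin k → Fin k → Matrix (Fin n) (Fin n) ℝ}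
    {A : Fin k → Fin k → Matrix (Fin n) (Fin n) ℝ}
    (hk : 0 < k) (hcont : ∀ i j, Continuous fun t => N t i j) (hN : ∀ t i j, ‖N t i j‖ ≤ 1)
    {x : ℝ → Fin k → Matrix (Fin n) (Fin n) ℝ} (hQ : ∀ t i, (x t i)ᵀ * x t i = 1)
    {a ε T c z : ℝ} (hT : 0 < T) (hε : 0 < ε) (hz : 0 ≤ z)
    (hx : ∀ t ∈ Set.Icc a (a + T),
      HasDerivWithinAt x (ε • couplingField (N t) (x t)) (Set.Icc a (a + T)) t)
    (hsmall : 2 * k * (1 + n) * ε * T ≤ 1)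
    (havg : ∀ i j, ‖∫ s in a..(a + T), (N s i j - A i j)‖ ≤ z)
    (hzT : 8 * (k : ℝ) ^ 2 * (k * (1 + n) * z) ≤ c * T)
    (hεT : 48 * (k : ℝ) ^ 2 * (2 * k * (1 + n)) ^ 2 * (ε * T) ≤ c)
    (hdiss : ∑ i, ∑ j, frobInner (x a i - x a j)
      (couplingField A (x a) i - couplingField A (x a) j) ≤ -c * disagreement (x a)) :
    disagreement (x (a + T)) ≤ Real.exp (-(ε * c) * T) * disagreement (x a) := by
  have hab : a ≤ a + T := by linarith
  have hT' : a + T - a = T := by ring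
  obtain ⟨h1, h2⟩ := couplingField_averaging hk hcont hN hQ hab hε hx (by rwa [hT'])
  rw [hT'] at h1 h2
  set ρ := √(disagreement (x a)) with hρ
  set C : ℝ := 2 * k * (1 + n) with hC
  have hint : ∀ i j, ‖(∫ s in a..(a + T), N s i j) - T • A i j‖ ≤ z := by
    intro i j
    have h := havg i j
    rw [intervalIntegral.integral_sub ((hcont i j).intervalIntegrable _ _)
      intervalIntegrable_const, intervalIntegral.integral_const, hT'] at h
    exact h
  have h3 := norm_couplingField_le hz hint (hQ a)
  rw [couplingField_sub_smul, ← hρ] at h3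
  have h4 : ‖x (a + T) - x a - (ε * T) • couplingField A (x a)‖ ≤
      (ε * (k * (1 + n) * z) + 2 * (C * ε * T) ^ 2) * ρ := by
    have h5 : x (a + T) - x a - (ε * T) • couplingField A (x a) =
        (x (a + T) - x a - ε • couplingField (fun i j => ∫ s in a..(a + T), N s i j) (x a)) +
        ε • (couplingField (fun i j => ∫ s in a..(a + T), N s i j) (x a) -
          T • couplingField A (x a)) := by
      rw [smul_sub, smul_smul]
      abel
    rw [h5]
    refine (norm_add_le _ _).trans ?_
    rw [norm_smul, Real.norm_of_nonneg hε.le]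
    have h6 := mul_le_mul_of_nonneg_left h3 hε.le
    linarith
  have h7 := disagreement_le_of_increment (Q := x a) (Q' := x (a + T))
    (F := couplingField A (x a)) (τ := ε * T) (p := 2 * (C * ε * T))
    (q := ε * (k * (1 + n) * z) + 2 * (C * ε * T) ^ 2) (by positivity) hdiss
    (fun i => (norm_le_pi_norm (x (a + T) - x a) i).trans (h1 _ (Set.right_mem_Icc.2 hab)))
    (fun i => (norm_le_pi_norm (x (a + T) - x a - (ε * T) • couplingField A (x a)) i).trans h4)
  -- By `hzT` the averaging defect costs at most εcT/2, and by `hεT` the quadratic terms 24k²(CεT)²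
  -- cost at most εcT/2. Of 1 - 2εcT this leaves 1 - εcT ≤ exp(-εcT).
  refine h7.trans (mul_le_mul_of_nonneg_right ?_ (disagreement_nonneg _))
  have h8 := Real.add_one_le_exp (-(ε * c) * T)
  have h9 := mul_le_mul_of_nonneg_left hzT hε.le
  have h10 := mul_le_mul_of_nonneg_left hεT (by positivity : 0 ≤ ε * T)
  linarith

/-- Bounded growth of the disagreement inside one averaging window. -/
theorem disagreement_window_growth {N : ℝ → Fin k → Fin k → Matrix (Fin n) (Fin n) ℝ}
    (hk : 0 < k) (hcont : ∀ i j, Continuous fun t => N t i j) (hN : ∀ t i j, ‖N t i j‖ ≤ 1)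
    {x : ℝ → Fin k → Matrix (Fin n) (Fin n) ℝ} (hQ : ∀ t i, (x t i)ᵀ * x t i = 1)
    {a b ε : ℝ} (hab : a ≤ b) (hε : 0 < ε)
    (hx : ∀ t ∈ Set.Icc a b,
      HasDerivWithinAt x (ε • couplingField (N t) (x t)) (Set.Icc a b) t)
    (hsmall : 2 * k * (1 + n) * ε * (b - a) ≤ 1) :
    disagreement (x b) ≤ 25 * (k : ℝ) ^ 2 * disagreement (x a) := by
  have h := (couplingField_averaging hk hcont hN hQ hab hε hx hsmall).1 b (Set.right_mem_Icc.2 hab)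
  refine disagreement_le_of_norm_sub_le fun i => ?_
  refine (norm_le_pi_norm (x b - x a) i).trans (h.trans ?_)
  gcongr
  linarith

end Window

/-! ### Comparison of the disagreement with the distance to synchronization -/

section Distance

variable {n k : ℕ}

theorem transpose_mul_self_of_mem {a : Matrix (Fin n) (Fin n) ℝ}
    (ha : a ∈ Matrix.specialOrthogonalGroup (Fin n) ℝ) : aᵀ * a = 1 :=
  (Matrix.mem_orthogonalGroup_iff' (Fin n) ℝ).1 (Matrix.mem_specialOrthogonalGroup_iff.1 ha).1

/-- Test the infimum with all agents in the state of `i₀`; the resulting sum is a single slice of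
the double sum. -/
theorem distTo_syncSet_le (i₀ : Fin k) (Q : State n k) :
    distTo (syncSet n k) Q ≤ √(disagreement fun i => (Q i).1) := by
  have hbdd : BddBelow (Set.range fun P : syncSet n k =>
      √(∑ i, ‖(Q i).1 - (P.1 i).1‖ ^ 2)) :=
    ⟨0, by rintro _ ⟨P, rfl⟩; exact Real.sqrt_nonneg _⟩
  refine (ciInf_le hbdd ⟨fun _ => Q i₀, fun _ _ => rfl⟩).trans (Real.sqrt_le_sqrt ?_)
  rw [disagreement, Finset.sum_comm]
  exact Finset.single_le_sum (f := fun j => ∑ i, ‖(Q i).1 - (Q j).1‖ ^ 2)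
    (fun j _ => Finset.sum_nonneg fun i _ => by positivity) (Finset.mem_univ i₀)

theorem sqrt_disagreement_le_distTo (hk : 0 < k) (Q : State n k) :
    √(disagreement fun i => (Q i).1) ≤ 2 * k * distTo (syncSet n k) Q := by
  have hk' : (0 : ℝ) < k := Nat.cast_pos.2 hk
  have : Nonempty (syncSet n k) := ⟨⟨fun _ => 1, fun _ _ => rfl⟩⟩
  rw [← div_le_iff₀' (by positivity)]
  refine le_ciInf fun P => ?_
  rw [div_le_iff₀' (by positivity)]
  set s := √(∑ i, ‖(Q i).1 - (P.1 i).1‖ ^ 2) with hs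
  have h1 : ∀ i, ‖(Q i).1 - (P.1 i).1‖ ≤ s := fun i => Real.le_sqrt_of_sq_le
    (Finset.single_le_sum (f := fun i => ‖(Q i).1 - (P.1 i).1‖ ^ 2)
      (fun i _ => by positivity) (Finset.mem_univ i))
  have h2 : ∀ i j, ‖(Q i).1 - (Q j).1‖ ≤ 2 * s := by
    intro i j
    have h3 := norm_sub_le_norm_sub_add_norm_sub (Q i).1 (P.1 i).1 (Q j).1
    have h4 := h1 j
    rw [norm_sub_rev, P.2 j i] at h4
    linarith [h1 i]
  refine Real.sqrt_le_iff.2 ⟨by positivity, ?_⟩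
  calc disagreement (fun i => (Q i).1) ≤ ∑ _i : Fin k, ∑ _j : Fin k, (2 * s) ^ 2 :=
        Finset.sum_le_sum fun i _ => Finset.sum_le_sum fun j _ =>
          pow_le_pow_left₀ (norm_nonneg _) (h2 i j) 2
    _ = (2 * k * s) ^ 2 := by
        simp only [Finset.sum_const, Finset.card_univ, Fintype.card_fin, nsmul_eq_mul]
        ring

end Distance

/-! ### The given dynamics as a coupling field -/

section Weights

variable {n k : ℕ}

theorem proj_transpose (v : EuclideanSpace ℝ (Fin n)) : (proj v)ᵀ = proj v := by
  ext a b
  simp [proj, mul_comm]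

theorem norm_proj (v : EuclideanSpace ℝ (Fin n)) : ‖proj v‖ = ‖v‖ ^ 2 := by
  have h : ‖proj v‖ ^ 2 = (‖v‖ ^ 2) ^ 2 := by
    rw [← frobInner_self, frobInner, proj_transpose, EuclideanSpace.real_norm_sq_eq, Matrix.trace,
      sq (∑ i, _), Finset.sum_mul_sum]
    refine Finset.sum_congr rfl fun a _ => ?_
    rw [Matrix.diag_apply, Matrix.mul_apply]
    refine Finset.sum_congr rfl fun b _ => ?_
    simp only [proj, Matrix.of_apply]
    ring
  exact (pow_left_inj₀ (norm_nonneg _) (by positivity) two_ne_zero).1 h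

theorem continuous_proj : Continuous (proj (n := n)) := by
  refine continuous_matrix fun a b => ?_
  simp only [proj, Matrix.of_apply]
  fun_prop

/-- The family of matrices on the edges of `G`, extended by zero off the edges. -/
def edgeWeight (G : SimpleGraph (Fin k)) [DecidableRel G.Adj]
    (M : Fin k → Fin k → Matrix (Fin n) (Fin n) ℝ) (i j : Fin k) : Matrix (Fin n) (Fin n) ℝ :=
  if G.Adj i j then M i j else 0

theorem field_eq_couplingField (G : SimpleGraph (Fin k)) [DecidableRel G.Adj]
    (y : Fin k → Fin k → ℝ → EuclideanSpace ℝ (Fin n)) (ε t : ℝ) (Q : State n k) (i : Fin k) :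
    field G y ε t Q i =
      (ε • couplingField (edgeWeight G fun i j => proj (y i j t)) fun i => (Q i).1) i := by
  rw [field, Pi.smul_apply, couplingField, Finset.mul_sum, SimpleGraph.neighborFinset_eq_filter,
    Finset.sum_filter]
  congr 1
  refine Finset.sum_congr rfl fun j _ => ?_
  by_cases h : G.Adj i j
  · rw [if_pos h, edgeWeight, if_pos h]
    exact mul_sk_eq_coupling (proj_transpose _)
      (mul_eq_one_comm.1 (transpose_mul_self_of_mem (Q i).2))
  · rw [if_neg h, edgeWeight, if_neg h, coupling_zero]

end Weights

/-! ### Exponential decay along solutions -/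

section Main

variable {n k : ℕ}

/-- Contraction of the disagreement along trajectories, uniform in the initial time, translates
into local exponential stability of the synchronization set. -/
theorem isLocallyExpStable_of_disagreement_decay {G : SimpleGraph (Fin k)} [DecidableRel G.Adj]
    {y : Fin k → Fin k → ℝ → EuclideanSpace ℝ (Fin n)} {ε δ K μ : ℝ} (hk : 0 < k) (hδ : 0 < δ)
    (hK : 0 < K) (hμ : 0 < μ)
    (h : ∀ (t₀ t₁ : ℝ) (Q : ℝ → State n k), t₀ ≤ t₁ → IsSolutionOn G y ε t₀ t₁ Q →
      √(disagreement fun i => (Q t₀ i).1) ≤ δ → ∀ t ∈ Set.Icc t₀ t₁,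
      (disagreement fun i => (Q t i).1) ≤
        K * Real.exp (-μ * (t - t₀)) * disagreement fun i => (Q t₀ i).1) :
    IsLocallyExpStable G y ε (syncSet n k) := by
  have hk' : (0 : ℝ) < k := Nat.cast_pos.2 hk
  -- The disagreement is quadratic in the distance, hence √K and μ/2; the factors 2k come from
  -- `sqrt_disagreement_le_distTo`.
  refine ⟨δ / (2 * k), by positivity, √K * (2 * k), by positivity, μ / 2, by positivity,
    fun t₀ t₁ Q ht hQ hd t htt => ?_⟩
  have h0 := sqrt_disagreement_le_distTo hk (Q t₀)
  have h1 : √(disagreement fun i => (Q t₀ i).1) ≤ δ :=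
    h0.trans ((lt_div_iff₀' (by positivity)).1 hd).le
  have h2 := h t₀ t₁ Q ht hQ h1 t htt
  have h3 : Real.exp (-μ * (t - t₀)) = Real.exp (-(μ / 2) * (t - t₀)) ^ 2 := by
    rw [sq, ← Real.exp_add]
    congr 1
    ring
  calc distTo (syncSet n k) (Q t) ≤ √(disagreement fun i => (Q t i).1) :=
        distTo_syncSet_le ⟨0, hk⟩ (Q t)
    _ ≤ √(K * Real.exp (-μ * (t - t₀)) * disagreement fun i => (Q t₀ i).1) :=
        Real.sqrt_le_sqrt h2
    _ = √K * Real.exp (-(μ / 2) * (t - t₀)) * √(disagreement fun i => (Q t₀ i).1) := by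
        rw [Real.sqrt_mul (by positivity), Real.sqrt_mul hK.le, h3,
          Real.sqrt_sq (Real.exp_nonneg _)]
    _ ≤ √K * Real.exp (-(μ / 2) * (t - t₀)) * (2 * k * distTo (syncSet n k) (Q t₀)) := by
        gcongr
    _ = _ := by ring

theorem exists_averaging_window {Z : ℝ → ℝ} (hZ : Tendsto (fun T : ℝ => (1 / T) * Z T) atTop (𝓝 0))
    {C c : ℝ} (hC : 0 < C) (hc : 0 < c) : ∃ T > (0 : ℝ), C * Z T ≤ c * T := by
  obtain ⟨T, hT1, hT⟩ := ((hZ.eventually (eventually_le_nhds (div_pos hc hC))).and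
    (eventually_gt_atTop 0)).exists
  refine ⟨T, hT, ?_⟩
  rw [one_div, inv_mul_le_iff₀ hT, ← mul_div_assoc, le_div_iff₀ hC] at hT1
  linarith

/-- Exponential decay of the disagreement along solutions for a fixed small coupling gain. -/
theorem disagreement_decay {G : SimpleGraph (Fin k)} [DecidableRel G.Adj]
    {y : Fin k → Fin k → ℝ → EuclideanSpace ℝ (Fin n)} (hy : IsReferenceFamily G y) (hk : 0 < k)
    {A : Fin k → Fin k → Matrix (Fin n) (Fin n) ℝ} {c δ T z ε : ℝ} (hc : 0 < c) (hT : 0 < T)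
    (hz : 0 ≤ z) (hε : 0 < ε)
    (havg : ∀ (a : ℝ) i j, G.Adj i j → ‖∫ s in a..(a + T), (proj (y i j s) - A i j)‖ ≤ z)
    (hoff : ∀ i j, ¬G.Adj i j → A i j = 0)
    (hdiss : ∀ Q : Fin k → Matrix (Fin n) (Fin n) ℝ, (∀ i, (Q i)ᵀ * Q i = 1) →
      √(disagreement Q) ≤ δ →
      ∑ i, ∑ j, frobInner (Q i - Q j) (couplingField A Q i - couplingField A Q j) ≤
        -c * disagreement Q)
    (hzT : 8 * (k : ℝ) ^ 2 * (k * (1 + n) * z) ≤ c * T)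
    (hsmall : 2 * k * (1 + n) * ε * T ≤ 1)
    (hεT : 48 * (k : ℝ) ^ 2 * (2 * k * (1 + n)) ^ 2 * (ε * T) ≤ c)
    (t₀ t₁ : ℝ) (Q : ℝ → State n k) (hsol : IsSolutionOn G y ε t₀ t₁ Q)
    (h0 : √(disagreement fun i => (Q t₀ i).1) ≤ δ) {t : ℝ} (ht : t ∈ Set.Icc t₀ t₁) :
    (disagreement fun i => (Q t i).1) ≤
      25 * (k : ℝ) ^ 2 * Real.exp (ε * c * T) * Real.exp (-(ε * c) * (t - t₀)) *
        disagreement fun i => (Q t₀ i).1 := by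
  set N : ℝ → Fin k → Fin k → Matrix (Fin n) (Fin n) ℝ :=
    fun t => edgeWeight G fun i j => proj (y i j t) with hNdef
  set x : ℝ → Fin k → Matrix (Fin n) (Fin n) ℝ := fun t i => (Q t i).1
  have hcont : ∀ i j, Continuous fun t => N t i j := by
    intro i j
    by_cases h : G.Adj i j
    · simp only [hNdef, edgeWeight, if_pos h]
      exact continuous_proj.comp (hy.smooth i j h).continuous
    · simp only [hNdef, edgeWeight, if_neg h]
      exact continuous_const
  have hN : ∀ t i j, ‖N t i j‖ ≤ 1 := by
    intro t i j
    by_cases h : G.Adj i j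
    · simp only [hNdef, edgeWeight, if_pos h]
      rw [norm_proj, hy.unit i j h, one_pow]
    · simp only [hNdef, edgeWeight, if_neg h]
      rw [norm_zero]
      exact zero_le_one
  have hQ : ∀ t i, (x t i)ᵀ * x t i = 1 := fun t i => transpose_mul_self_of_mem (Q t i).2
  have havg' : ∀ a i j, ‖∫ s in a..(a + T), (N s i j - A i j)‖ ≤ z := by
    intro a i j
    by_cases h : G.Adj i j
    · simp only [hNdef, edgeWeight, if_pos h]
      exact havg a i j h
    · simp only [hNdef, edgeWeight, if_neg h, hoff i j h, sub_zero]
      simpa using hz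
  have hx : ∀ a b, t₀ ≤ a → b ≤ t₁ → ∀ t ∈ Set.Icc a b,
      HasDerivWithinAt x (ε • couplingField (N t) (x t)) (Set.Icc a b) t := by
    intro a b ha hb t ht
    refine hasDerivWithinAt_pi.2 fun i => ?_
    have h := (hsol t ⟨ha.trans ht.1, ht.2.trans hb⟩ i).mono (Set.Icc_subset_Icc ha hb)
    rwa [field_eq_couplingField] at h
  refine exp_decay_of_window_contraction (g := fun t => disagreement (x t)) hT (by positivity)
    (by positivity) (fun t => disagreement_nonneg _) ?_ ?_ h0 ht
  · intro a ha hb hδ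
    exact disagreement_window_contraction hk hcont hN hQ hT hε hz (hx a _ ha hb) hsmall (havg' a)
      hzT hεT (hdiss _ (hQ a) hδ)
  · intro a b ha hab hb hbT
    refine disagreement_window_growth hk hcont hN hQ hab hε (hx a b ha hb) (le_trans ?_ hsmall)
    gcongr
    linarith

end Main

end PartialSync

end

theorem mainTheorem2 (n k : ℕ) (hn : 2 ≤ n) (G : SimpleGraph (Fin k)) [DecidableRel G.Adj]
    (hG : G.Connected) (y : Fin k → Fin k → ℝ → EuclideanSpace ℝ (Fin n))
    (hy : PartialSync.IsReferenceFamily G y) (hex : PartialSync.PersistentlyExciting G y) :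
    ∃ ε₀ > (0 : ℝ), ∀ ε : ℝ, 0 < ε → ε < ε₀ →
      PartialSync.IsLocallyExpStable G y ε (PartialSync.syncSet n k) := by
  obtain ⟨Mbar, hM, Z, hZ0, hZ, hZb⟩ := hex
  have hk : 0 < k := Fin.pos_iff_nonempty.2 hG.nonempty
  have hk' : (0 : ℝ) < k := Nat.cast_pos.2 hk
  have hsymm : ∀ i j, PartialSync.edgeWeight G Mbar i j = PartialSync.edgeWeight G Mbar j i := by
    intro i j
    by_cases h : G.Adj i j
    · rw [PartialSync.edgeWeight, PartialSync.edgeWeight, if_pos h, if_pos h.symm]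
      have h1 := (hM i j h).1
      rw [hy.symm i j h] at h1
      exact tendsto_nhds_unique h1 (hM j i h.symm).1
    · rw [PartialSync.edgeWeight, PartialSync.edgeWeight, if_neg h, if_neg fun h' => h h'.symm]
  have hoff : ∀ i j, ¬G.Adj i j → PartialSync.edgeWeight G Mbar i j = 0 := fun i j h => if_neg h
  obtain ⟨l, hl, hco⟩ := PartialSync.exists_uniform_coercive
    (fun p : Fin k × Fin k => G.Adj p.1 p.2) (M := fun p => PartialSync.edgeWeight G Mbar p.1 p.2)
    (fun p hp => by
      rw [PartialSync.edgeWeight, if_pos hp]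
      exact (hM p.1 p.2 hp).2)
  obtain ⟨c, hc, δ, hδ, hdiss⟩ := PartialSync.exists_dissipation hG hsymm hoff hl
    (fun i j h => hco (i, j) h)
  -- T is fixed before ε, since ε cancels when the averaging defect is compared with the
  -- dissipation.
  obtain ⟨T, hT, hzT⟩ := PartialSync.exists_averaging_window hZ
    (C := 8 * (k : ℝ) ^ 2 * (k * (1 + n))) (by positivity) hc
  -- The first bound validates the Grönwall linearization, the second absorbs the errors quadratic
  -- in εT.
  refine ⟨min (1 / (2 * k * (1 + n) * T))
    (c / (48 * (k : ℝ) ^ 2 * (2 * k * (1 + n)) ^ 2 * T)), by positivity, fun ε hε hlt => ?_⟩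
  have h1 := (lt_div_iff₀ (by positivity)).1 (hlt.trans_le (min_le_left _ _))
  have h2 := (lt_div_iff₀ (by positivity)).1 (hlt.trans_le (min_le_right _ _))
  refine PartialSync.isLocallyExpStable_of_disagreement_decay hk hδ
    (K := 25 * (k : ℝ) ^ 2 * Real.exp (ε * c * T)) (μ := ε * c) (by positivity) (by positivity)
    fun t₀ t₁ Q _ hsol h0 t ht => ?_
  refine PartialSync.disagreement_decay hy hk hc hT (hZ0 T hT.le) hε (fun a i j h => ?_) hoff hdiss
    (by linarith) (by linarith) (by linarith) t₀ t₁ Q hsol h0 ht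
  rw [PartialSync.edgeWeight, if_pos h]
  exact hZb i j h a T hT.le
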